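/- Let $\Bbbk$ be an algebraically closed field and $A$ a finite-dimensional Hopf algebra over $\Bbbk$ with antipode $S$; all $A$-modules are left modules, finite-dimensional over $\Bbbk$, and $\otimes=\otimes_{\Bbbk}$. Let $A$ act on a tensor product $U\otimes W$ of modules through the coproduct, and on the dual space $W^*$ of a module by $(af)(w)=f(S(a)w)$. Let $S_1,\dots,S_m$ be the simple $A$-modules, each isomorphism class listed once, and let $P_i$ be the projective cover of $S_i$, i.e. the indecomposable projective module with $P_i/\operatorname{rad}P_i\cong S_i$. For a module $N$ write $[N:S_j]$ for the multiplicity of $S_j$ as a composition factor of $N$; for a projective module $X$ write $[X:P_j]$ for the multiplicity of $P_j$ in a decomposition of $X$ into indecomposable projectives, i.e. the coefficient of $[P_j]$ in the class of $X$ in $K_0(A)$. For a module $V$ let $$(M_V)_{ij}=[S_i\otimes V:S_j],\qquad (Q_V)_{ij}=[P_i\otimes V:P_j],\qquad C_{ij}=[P_i:S_j]\qquad(1\le i,j\le m)$$ be the McKay matrix of $V$, the projective McKay matrix of $V$ and the Cartan matrix of $A$, as integer matrices. **Theorem.** Let $V$ be an $A$-module. For every $i$ there is exactly one family $(n_j)_j$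 of natural numbers with $P_i\otimes V\cong\bigoplus_j P_j^{\oplus n_j}$, namely $n_j=(Q_V)_{ij}$ (so $Q_V$ is well defined), and for all $i,j$ $$(Q_V)_{ij}=\dim_{\Bbbk}\operatorname{Hom}_A(P_i\otimes V,S_j)=\dim_{\Bbbk}\operatorname{Hom}_A(P_i,S_j\otimes V^*)=[S_j\otimes V^*:S_i]=(M_{V^*})_{ji}.$$ Therefore $Q_V=M_{V^*}^{T}$. Moreover, for every field $F$: (a) $M_{V^*}^{T}\,C=C\,M_V$. (b) If $v\in F^m$ is a column vector with $M_Vv=\lambda v$, $\lambda\in F$, then $M_{V^*}^{T}(Cv)=\lambda\,Cv$; if $w$ is a row vector over $F$ with $wM_{V^*}^{T}=\mu w$, $\mu\in F$, then $(wC)M_V=\mu\,wC$. (So $Cv$ and $wC$ are eigenvectors whenever they are nonzero.) (c) If $C$ is invertible over $F$, then $M_{V^*}^{T}=C\,M_V\,C^{-1}$ over $F$. If $\det C\ne 0$ in $\mathbb Z$, then $M_V$, $M_{V^*}^{T}$ and $M_{V^*}$ have the same characteristic polynomial over $\mathbb Z$, and the same eigenvalues in $F$. (d) If $A$ is semisimple,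 then $C$ is the identity matrix and $M_{V^*}^{T}=M_V$. If in addition $V\cong V^*$ as $A$-modules, then $M_V$ is symmetric, hence orthogonally diagonalizable: $M_V=ODO^{T}$ with $O$ a real orthogonal and $D$ a real diagonal matrix. -/

import Mathlib

open scoped TensorProduct

universe u

noncomputable section

namespace McKay

/-! ### Tensor products and duals of modules over a Hopf algebra -/

section HopfModules

variable (k A U V : Type*) [Field k] [Ring A] [HopfAlgebra k A]
  [AddCommGroup U] [Module k U] [Module A U] [IsScalarTower k A U]
  [AddCommGroup V] [Module k V] [Module A V] [IsScalarTower k A V]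

/-- The tensor product `U ⊗ V` over `k` of two modules over the Hopf algebra `A`. It is a type
synonym, so that `A` acts through the coproduct and not on the left factor only. -/
def HopfTensor (k A U V : Type*) [Field k] [Ring A] [HopfAlgebra k A]
    [AddCommGroup U] [Module k U] [AddCommGroup V] [Module k V] : Type _ :=
  U ⊗[k] V

instance : AddCommGroup (HopfTensor k A U V) := inferInstanceAs (AddCommGroup (U ⊗[k] V))

instance : Module k (HopfTensor k A U V) := inferInstanceAs (Module k (U ⊗[k] V))

/-- The algebra homomorphism `A → A ⊗ A → End U ⊗ End V → End (U ⊗ V)`. -/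
def tensorAction : A →ₐ[k] Module.End k (U ⊗[k] V) :=
  (Module.endTensorEndAlgHom (R := k) (S := k) (A := k) (M := U) (N := V)).comp
    ((Algebra.TensorProduct.map (Algebra.lsmul k k U) (Algebra.lsmul k k V)).comp
      (Bialgebra.comulAlgHom k A))

instance : Module A (HopfTensor k A U V) where
  smul a x := tensorAction k A U V a x
  one_smul x := congrArg (fun f : Module.End k (U ⊗[k] V) => f x) (map_one (tensorAction k A U V))
  mul_smul a b x :=
    congrArg (fun f : Module.End k (U ⊗[k] V) => f x) (map_mul (tensorAction k A U V) a b)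
  smul_zero a := map_zero (tensorAction k A U V a)
  smul_add a := map_add (tensorAction k A U V a)
  add_smul a b x :=
    congrArg (fun f : Module.End k (U ⊗[k] V) => f x) (map_add (tensorAction k A U V) a b)
  zero_smul x := congrArg (fun f : Module.End k (U ⊗[k] V) => f x) (map_zero (tensorAction k A U V))

instance : IsScalarTower k A (HopfTensor k A U V) where
  smul_assoc c a x :=
    congrArg (fun f : Module.End k (U ⊗[k] V) => f x) (map_smul (tensorAction k A U V) c a)

/-- In Sweedler notation: `a (u ⊗ v) = ∑ a₍₁₎ u ⊗ a₍₂₎ v`. -/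
theorem tensorAction_tmul {ι : Type*} (a : A) (r : Coalgebra.Repr k a ι) (u : U) (v : V) :
    tensorAction k A U V a (u ⊗ₜ[k] v) =
      ∑ i ∈ r.index, (r.left i • u) ⊗ₜ[k] (r.right i • v) := by
  simp only [tensorAction, AlgHom.comp_apply, Bialgebra.comulAlgHom_apply, ← r.eq, map_sum,
    LinearMap.sum_apply, Algebra.TensorProduct.map_tmul]
  rfl

/-- The dual `V*` of a module over the Hopf algebra `A`, as a type synonym of the space of linear
forms on `V`; `A` acts by `(a f)(v) = f (S(a) v)` where `S` is the antipode. -/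
def HopfDual (k A V : Type*) [Field k] [Ring A] [HopfAlgebra k A]
    [AddCommGroup V] [Module k V] : Type _ :=
  Module.Dual k V

instance : AddCommGroup (HopfDual k A V) := inferInstanceAs (AddCommGroup (Module.Dual k V))

instance : Module k (HopfDual k A V) := inferInstanceAs (Module k (Module.Dual k V))

/-- The action of `a` on the space of linear forms: the transpose of the action of `S(a)`. -/
def dualAction (a : A) : Module.End k (Module.Dual k V) :=
  (Algebra.lsmul k k V (HopfAlgebraStruct.antipode k a)).dualMap

theorem dualAction_apply (a : A) (f : Module.Dual k V) (v : V) :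
    dualAction k A V a f v = f (HopfAlgebraStruct.antipode k a • v) := rfl

theorem dualAction_one (f : Module.Dual k V) : dualAction k A V 1 f = f := by
  ext v
  rw [dualAction_apply, HopfAlgebra.antipode_one, one_smul]

theorem dualAction_mul (a b : A) (f : Module.Dual k V) :
    dualAction k A V (a * b) f = dualAction k A V a (dualAction k A V b f) := by
  ext v
  simp only [dualAction_apply, HopfAlgebra.antipode_mul_antidistrib, mul_smul]

theorem dualAction_add (a b : A) (f : Module.Dual k V) :
    dualAction k A V (a + b) f = dualAction k A V a f + dualAction k A V b f := by
  ext v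
  simp only [dualAction_apply, map_add, add_smul, LinearMap.add_apply]

theorem dualAction_smul (c : k) (a : A) (f : Module.Dual k V) :
    dualAction k A V (c • a) f = c • dualAction k A V a f := by
  ext v
  simp only [dualAction_apply, map_smul, smul_assoc, LinearMap.smul_apply]

theorem dualAction_zero (f : Module.Dual k V) : dualAction k A V 0 f = 0 := by
  ext v
  simp only [dualAction_apply, map_zero, zero_smul, LinearMap.zero_apply]

instance : Module A (HopfDual k A V) where
  smul a f := dualAction k A V a f
  one_smul f := dualAction_one k A V f
  mul_smul a b f := dualAction_mul k A V a b f
  smul_zero a := map_zero (dualAction k A V a)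
  smul_add a := map_add (dualAction k A V a)
  add_smul a b f := dualAction_add k A V a b f
  zero_smul f := dualAction_zero k A V f

instance : IsScalarTower k A (HopfDual k A V) where
  smul_assoc c a f := dualAction_smul k A V c a f

end HopfModules

/-! ### Multiplicities -/

section Multiplicities

variable (A : Type*) [Ring A]

/-- The number of factors of a composition series that are isomorphic to `T`. -/
def seriesMult {N : Type*} [AddCommGroup N] [Module A N] (s : CompositionSeries (Submodule A N))
    (T : Type*) [AddCommGroup T] [Module A T] : ℕ :=
  Nat.card {i : Fin s.length //
    Nonempty ((s i.succ ⧸ (s i.castSucc).comap (s i.succ).subtype) ≃ₗ[A] T)}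

open Classical in
/-- The multiplicity `[N : T]` of `T` as a composition factor of a module `N` of finite length,
computed in some composition series of `N` (see `compMult_eq` for the independence). -/
def compMult (N T : Type*) [AddCommGroup N] [Module A N] [AddCommGroup T] [Module A T] : ℕ :=
  if h : ∃ s : CompositionSeries (Submodule A N), s.head = ⊥ ∧ s.last = ⊤ then
    seriesMult A h.choose T
  else 0

theorem compMult_eq {N T : Type*} [AddCommGroup N] [Module A N] [AddCommGroup T] [Module A T]
    (s : CompositionSeries (Submodule A N)) (h0 : s.head = ⊥) (h1 : s.last = ⊤) :
    compMult A N T = seriesMult A s T := by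
  have h : ∃ s : CompositionSeries (Submodule A N), s.head = ⊥ ∧ s.last = ⊤ := ⟨s, h0, h1⟩
  rw [compMult, dif_pos h]
  obtain ⟨f, hf⟩ := CompositionSeries.jordan_holder h.choose s (h.choose_spec.1.trans h0.symm)
    (h.choose_spec.2.trans h1.symm)
  refine Nat.card_congr (f.subtypeEquiv fun i => ?_)
  exact ⟨fun ⟨e⟩ => ⟨(hf i).linearEquiv.symm.trans e⟩, fun ⟨e⟩ => ⟨(hf i).linearEquiv.trans e⟩⟩

variable {ι : Type*}

open Classical in
/-- The multiplicities `[X : P j]`: the exponents in a decomposition `X ≅ ⨁ j, (P j) ^ (n j)`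
(`ι` is finite in all uses, so that the product is a direct sum). For pairwise nonisomorphic
indecomposable projective modules `P j` of finite dimension, this is the coefficient of `[P j]`
when `[X]` is expanded in the split Grothendieck group. -/
def decompMult (P : ι → Type*) [∀ j, AddCommGroup (P j)] [∀ j, Module A (P j)]
    (X : Type*) [AddCommGroup X] [Module A X] : ι → ℕ :=
  if h : ∃ n : ι → ℕ, Nonempty (X ≃ₗ[A] ((j : ι) → Fin (n j) → P j)) then h.choose else 0

/-- `S` lists the simple `A`-modules up to isomorphism, each of them once. (Every simple
module is a quotient of `A`, so it is enough to consider those in the universe of `A`.) -/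
structure IsSimpleList {A : Type u} [Ring A] (S : ι → Type*) [∀ i, AddCommGroup (S i)]
    [∀ i, Module A (S i)] : Prop where
  simple : ∀ i, IsSimpleModule A (S i)
  nonisomorphic : ∀ i j, Nonempty (S i ≃ₗ[A] S j) → i = j
  exhaustive : ∀ (T : Type u) [AddCommGroup T] [Module A T], IsSimpleModule A T →
    ∃ i, Nonempty (T ≃ₗ[A] S i)

/-- `P` is a projective cover of the simple module `S`: an indecomposable projective module with
`P / rad P` isomorphic to `S`. -/
structure IsProjectiveCover (P S : Type*) [AddCommGroup P] [Module A P] [AddCommGroup S]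
    [Module A S] : Prop where
  projective : Module.Projective A P
  nontrivial : Nontrivial P
  indecomposable : ∀ N N' : Submodule A P, IsCompl N N' → N = ⊥ ∨ N' = ⊥
  top_equiv : Nonempty ((P ⧸ Module.jacobson A P) ≃ₗ[A] S)

end Multiplicities

/-! ### The matrices -/

section Matrices

variable (k A : Type*) [Field k] [Ring A] [HopfAlgebra k A] {ι : Type*}

/-- The McKay matrix `M_V`, with entries `[S i ⊗ V : S j]`. -/
def mckayMatrix (S : ι → Type*) [∀ i, AddCommGroup (S i)] [∀ i, Module k (S i)]
    [∀ i, Module A (S i)] [∀ i, IsScalarTower k A (S i)]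
    (V : Type*) [AddCommGroup V] [Module k V] [Module A V] [IsScalarTower k A V] :
    Matrix ι ι ℤ :=
  Matrix.of fun i j => (compMult A (HopfTensor k A (S i) V) (S j) : ℤ)

/-- The projective McKay matrix `Q_V`, with entries `[P i ⊗ V : P j]`. -/
def projMckayMatrix (P : ι → Type*) [∀ i, AddCommGroup (P i)] [∀ i, Module k (P i)]
    [∀ i, Module A (P i)] [∀ i, IsScalarTower k A (P i)]
    (V : Type*) [AddCommGroup V] [Module k V] [Module A V] [IsScalarTower k A V] :
    Matrix ι ι ℤ :=
  Matrix.of fun i j => (decompMult A P (HopfTensor k A (P i) V) j : ℤ)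

/-- The Cartan matrix, with entries `[P i : S j]`. -/
def cartanMatrix (A : Type*) [Ring A] (P S : ι → Type*) [∀ i, AddCommGroup (P i)]
    [∀ i, Module A (P i)] [∀ i, AddCommGroup (S i)] [∀ i, Module A (S i)] : Matrix ι ι ℤ :=
  Matrix.of fun i j => (compMult A (P i) (S j) : ℤ)

end Matrices

end McKay

end

/-! All multiplicities are dimensions of Hom spaces. The functor `Hom_A(P_j, -)` is exact, and by
Schur's lemma over an algebraically closed field `dim Hom_A(P_i, S_j)` is the Kronecker delta; hence
`[N : S_j] = dim Hom_A(P_j, N)`, and for projective `X` the coefficient of `P_j` is `dim Hom_A(X,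
S_j)` (`compMult_eq_finrank`, `decompMult_eq`).

The Hopf structure enters through the natural isomorphism `Hom_A(U ⊗ V, W) ≅ Hom_A(U, W ⊗ V*)`
(`adjunction`). As `- ⊗ V*` preserves surjections, `P_i ⊗ V` is projective; taking dimensions with
`U = P_i`, `W = S_j` gives `Q_V = M_{V*}ᵀ`.

The relation `Q_V C = C M_V` counts `[P_i ⊗ V : S_j]` twice: split `P_i ⊗ V` into indecomposable
projectives, or filter `P_i` by its composition factors and apply the exact functor `- ⊗ V`. The
statements on eigenvectors, characteristic polynomials and the semisimple case are then linear
algebra. -/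

noncomputable section

namespace McKay

/-! ### The tensor-dual adjunction for modules over a Hopf algebra. -/

section Adjunction

variable {k A : Type*} [Field k] [Ring A] [HopfAlgebra k A]

/-- In Sweedler notation `a₍₁₎ ⊗ S(a₍₂₎)a₍₃₎ = a ⊗ 1`, tested on a bilinear map `B`. Coassociativity
moves the second coproduct to the right factor, where the antipode axiom turns it into a counit.
This form and its twin with `a₍₂₎S(a₍₃₎)` serve the two directions of the adjunction. -/
theorem sum_antipode_mul_cancel {X : Type*} [AddCommGroup X] [Module k X]
    (B : A →ₗ[k] A →ₗ[k] X) {ι κ : Type*} {a : A} (r : Coalgebra.Repr k a ι)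
    (s : ∀ i, Coalgebra.Repr k (r.left i) κ) :
    ∑ i ∈ r.index, ∑ j ∈ (s i).index,
      B ((s i).left j) (HopfAlgebraStruct.antipode k ((s i).right j) * r.right i) = B a 1 := by
  let t := fun i => Coalgebra.Repr.arbitrary k (r.right i)
  let T : A ⊗[k] (A ⊗[k] A) →ₗ[k] X := TensorProduct.lift
    ((LinearMap.lcomp k X (LinearMap.mul' k A ∘ₗ
      (HopfAlgebraStruct.antipode k).rTensor A)) ∘ₗ B)
  have h := congrArg T (Coalgebra.sum_tmul_tmul_eq r s t)
  simp only [map_sum, T, TensorProduct.lift.tmul, LinearMap.comp_apply, LinearMap.lcomp_apply,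
    LinearMap.rTensor_tmul, LinearMap.mul'_apply] at h
  rw [h]
  simp only [← map_sum, HopfAlgebra.sum_antipode_mul_eq_smul, map_smul]
  -- What is left is `∑ ε(a₍₂₎) B(a₍₁₎, 1)`, which the counit axiom evaluates.
  have h' := congrArg (TensorProduct.lift ((LinearMap.lsmul k X).flip.comp (B.flip 1)))
    (Coalgebra.sum_tmul_counit_eq r)
  simpa only [map_sum, TensorProduct.lift.tmul, LinearMap.comp_apply, LinearMap.flip_apply,
    LinearMap.lsmul_apply, one_smul] using h'

theorem sum_mul_antipode_cancel {X : Type*} [AddCommGroup X] [Module k X]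
    (B : A →ₗ[k] A →ₗ[k] X) {ι κ : Type*} {a : A} (r : Coalgebra.Repr k a ι)
    (s : ∀ i, Coalgebra.Repr k (r.left i) κ) :
    ∑ i ∈ r.index, ∑ j ∈ (s i).index,
      B ((s i).left j) ((s i).right j * HopfAlgebraStruct.antipode k (r.right i)) = B a 1 := by
  let t := fun i => Coalgebra.Repr.arbitrary k (r.right i)
  let T : A ⊗[k] (A ⊗[k] A) →ₗ[k] X := TensorProduct.lift
    ((LinearMap.lcomp k X (LinearMap.mul' k A ∘ₗ
      (HopfAlgebraStruct.antipode k).lTensor A)) ∘ₗ B)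
  have h := congrArg T (Coalgebra.sum_tmul_tmul_eq r s t)
  simp only [map_sum, T, TensorProduct.lift.tmul, LinearMap.comp_apply, LinearMap.lcomp_apply,
    LinearMap.lTensor_tmul, LinearMap.mul'_apply] at h
  rw [h]
  simp only [← map_sum, HopfAlgebra.sum_mul_antipode_eq_smul, map_smul]
  have h' := congrArg (TensorProduct.lift ((LinearMap.lsmul k X).flip.comp (B.flip 1)))
    (Coalgebra.sum_tmul_counit_eq r)
  simpa only [map_sum, TensorProduct.lift.tmul, LinearMap.comp_apply, LinearMap.flip_apply,
    LinearMap.lsmul_apply, one_smul] using h'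

variable {U U' V W W' : Type*}
  [AddCommGroup U] [Module k U] [Module A U] [IsScalarTower k A U]
  [AddCommGroup U'] [Module k U'] [Module A U'] [IsScalarTower k A U']
  [AddCommGroup V] [Module k V] [Module A V] [IsScalarTower k A V]
  [AddCommGroup W] [Module k W] [Module A W] [IsScalarTower k A W]
  [AddCommGroup W'] [Module k W'] [Module A W'] [IsScalarTower k A W']

instance [FiniteDimensional k U] [FiniteDimensional k V] :
    FiniteDimensional k (HopfTensor k A U V) :=
  inferInstanceAs (FiniteDimensional k (U ⊗[k] V))

instance [FiniteDimensional k V] : FiniteDimensional k (HopfDual k A V) :=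
  inferInstanceAs (FiniteDimensional k (Module.Dual k V))

variable (k A U V) in
/-- The bilinear map `(u, v) ↦ u ⊗ v`. -/
def HopfTensor.tmul : U →ₗ[k] V →ₗ[k] HopfTensor k A U V := TensorProduct.mk k U V

theorem HopfTensor.smul_tmul {ι : Type*} (a : A) (r : Coalgebra.Repr k a ι) (u : U) (v : V) :
    a • tmul k A U V u v = ∑ i ∈ r.index, tmul k A U V (r.left i • u) (r.right i • v) :=
  tensorAction_tmul k A U V a r u v

theorem HopfTensor.induction {U V X : Type*} [AddCommGroup U] [Module k U] [AddCommGroup V]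
    [Module k V] [AddCommGroup X] [Module k X]
    {f g : HopfTensor k A U V →ₗ[k] X}
    (h : ∀ u v, f (tmul k A U V u v) = g (tmul k A U V u v)) (x : HopfTensor k A U V) :
    f x = g x :=
  congrArg (fun F : U ⊗[k] V →ₗ[k] X => F x) (TensorProduct.ext' h)

/-- A `k`-linear map out of `U ⊗ V` that is equivariant on pure tensors is `A`-linear. -/
def HopfTensor.equivariant {X : Type*} [AddCommGroup X] [Module k X] [Module A X]
    [IsScalarTower k A X] (f : HopfTensor k A U V →ₗ[k] X)
    (h : ∀ (a : A) u v, f (a • tmul k A U V u v) = a • f (tmul k A U V u v)) :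
    HopfTensor k A U V →ₗ[A] X :=
  { f with
    map_smul' := fun a => HopfTensor.induction (f := f ∘ₗ Algebra.lsmul k k _ a)
      (g := Algebra.lsmul k k _ a ∘ₗ f) (h a) }

variable (k V) in
/-- The functor `- ⊗ V` on morphisms. -/
def HopfTensor.map (f : U →ₗ[A] U') : HopfTensor k A U V →ₗ[A] HopfTensor k A U' V :=
  let L : HopfTensor k A U V →ₗ[k] HopfTensor k A U' V := (f.restrictScalars k).rTensor V
  HopfTensor.equivariant L fun a u v => by
    have h (u : U) (v : V) : L (tmul k A U V u v) = tmul k A U' V (f u) v := rfl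
    rw [h, smul_tmul a (Coalgebra.Repr.arbitrary k a), smul_tmul a (Coalgebra.Repr.arbitrary k a),
      map_sum]
    exact Finset.sum_congr rfl fun i _ => by rw [h, f.map_smul]

theorem HopfTensor.map_surjective {f : U →ₗ[A] U'} (hf : Function.Surjective f) :
    Function.Surjective (HopfTensor.map k V f) :=
  LinearMap.rTensor_surjective V (g := f.restrictScalars k) hf

theorem HopfTensor.map_injective {f : U →ₗ[A] U'} (hf : Function.Injective f) :
    Function.Injective (HopfTensor.map k V f) :=
  Module.Flat.rTensor_preserves_injective_linearMap (M := V) (f.restrictScalars k) hf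

theorem HopfTensor.map_exact {f : U →ₗ[A] U'} {g : U' →ₗ[A] W} (h : Function.Exact f g)
    (hg : Function.Surjective g) :
    Function.Exact (HopfTensor.map k V f) (HopfTensor.map k V g) :=
  rTensor_exact (f := f.restrictScalars k) (g := g.restrictScalars k) V h hg

variable (k V) in
/-- The functor `- ⊗ V` on isomorphisms. -/
def HopfTensor.congr (e : U ≃ₗ[A] U') : HopfTensor k A U V ≃ₗ[A] HopfTensor k A U' V :=
  LinearEquiv.ofBijective (HopfTensor.map k V e.toLinearMap)
    ⟨HopfTensor.map_injective e.injective, HopfTensor.map_surjective e.surjective⟩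

/-- The functor `U ⊗ -` on isomorphisms. -/
def HopfTensor.congrRight (U : Type*) [AddCommGroup U] [Module k U] [Module A U]
    [IsScalarTower k A U] (e : W ≃ₗ[A] W') :
    HopfTensor k A U W ≃ₗ[A] HopfTensor k A U W' :=
  let E : HopfTensor k A U W ≃ₗ[k] HopfTensor k A U W' := (e.restrictScalars k).lTensor U
  LinearEquiv.ofBijective (HopfTensor.equivariant E.toLinearMap fun a u v => by
    have h (u : U) (v : W) : E.toLinearMap (tmul k A U W u v) = tmul k A U W' u (e v) := rfl
    rw [h, smul_tmul a (Coalgebra.Repr.arbitrary k a), smul_tmul a (Coalgebra.Repr.arbitrary k a),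
      map_sum]
    exact Finset.sum_congr rfl fun i _ => by rw [h, e.map_smul]) E.bijective

variable [FiniteDimensional k V]

variable (k A V W) in
/-- The identification of `W ⊗ V*` with the space of linear maps from `V` to `W`. -/
def tensorDualEquiv : HopfTensor k A W (HopfDual k A V) ≃ₗ[k] (V →ₗ[k] W) :=
  (TensorProduct.comm k W (Module.Dual k V)).trans (dualTensorHomEquiv k V W)

/-- Makes equivariance of maps into `W ⊗ V*` a pointwise check on linear maps `V → W`, with the
antipode acting on the argument. -/
theorem tensorDualEquiv_smul {ι : Type*} (a : A) (r : Coalgebra.Repr k a ι)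
    (x : HopfTensor k A W (HopfDual k A V)) (v : V) :
    tensorDualEquiv k A V W (a • x) v =
      ∑ i ∈ r.index, r.left i •
        tensorDualEquiv k A V W x (HopfAlgebraStruct.antipode k (r.right i) • v) := by
  have := HopfTensor.induction (A := A) (U := W) (V := HopfDual k A V)
    (f := LinearMap.applyₗ v ∘ₗ (tensorDualEquiv k A V W).toLinearMap ∘ₗ Algebra.lsmul k k _ a)
    (g := ∑ i ∈ r.index, Algebra.lsmul k k W (r.left i) ∘ₗ
        LinearMap.applyₗ (HopfAlgebraStruct.antipode k (r.right i) • v) ∘ₗ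
          (tensorDualEquiv k A V W).toLinearMap) (fun w f => ?_) x
  · simpa only [LinearMap.sum_apply] using! this
  · simp only [LinearMap.comp_apply, LinearMap.sum_apply, Algebra.lsmul_coe,
      HopfTensor.smul_tmul a r, map_sum]
    refine Finset.sum_congr rfl fun i _ => ?_
    change f.toFun (HopfAlgebraStruct.antipode k (r.right i) • v) • (r.left i • w) =
      r.left i • (f.toFun (HopfAlgebraStruct.antipode k (r.right i) • v) • w)
    rw [smul_comm]

theorem tensorDualEquiv_map (g : W →ₗ[A] W') (x : HopfTensor k A W (HopfDual k A V)) (v : V) :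
    tensorDualEquiv k A V W' (HopfTensor.map k (HopfDual k A V) g x) v =
      g (tensorDualEquiv k A V W x v) := by
  refine HopfTensor.induction
    (f := LinearMap.applyₗ v ∘ₗ (tensorDualEquiv k A V W').toLinearMap ∘ₗ
      (HopfTensor.map k (HopfDual k A V) g).restrictScalars k)
    (g := g.restrictScalars k ∘ₗ LinearMap.applyₗ v ∘ₗ (tensorDualEquiv k A V W).toLinearMap)
    (fun w f => ?_) x
  exact (g.map_smul_of_tower (f.toFun v : k) w).symm

variable (k A U V W) in
/-- A linear map `U ⊗ V → W` as a linear map `U → W ⊗ V*`. -/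
def adjunctionLinear :
    (HopfTensor k A U V →ₗ[k] W) ≃ₗ[k] (U →ₗ[k] HopfTensor k A W (HopfDual k A V)) :=
  (TensorProduct.lift.equiv (RingHom.id k) U V W).symm.trans
    ((tensorDualEquiv k A V W).symm.congrRight)

omit [Module A U] [IsScalarTower k A U] [Module A V] [IsScalarTower k A V] [Module A W]
  [IsScalarTower k A W] in
theorem tensorDualEquiv_adjunctionLinear (f : HopfTensor k A U V →ₗ[k] W) (u : U) (v : V) :
    tensorDualEquiv k A V W (adjunctionLinear k A U V W f u) v =
      f (HopfTensor.tmul k A U V u v) :=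
  congrArg (fun F : V →ₗ[k] W => F v) ((tensorDualEquiv k A V W).apply_symm_apply _)

/-- Pointwise: `a₍₁₎ f(u ⊗ S(a₍₂₎)v) = f(a₍₁₎u ⊗ a₍₂₎S(a₍₃₎)v) = f(au ⊗ v)`. -/
theorem adjunctionLinear_smul (f : HopfTensor k A U V →ₗ[A] W) (a : A) (u : U) :
    adjunctionLinear k A U V W (f.restrictScalars k) (a • u) =
      a • adjunctionLinear k A U V W (f.restrictScalars k) u := by
  apply (tensorDualEquiv k A V W).injective
  ext v
  let r := Coalgebra.Repr.arbitrary k a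
  let s := fun i => Coalgebra.Repr.arbitrary k (r.left i)
  rw [tensorDualEquiv_smul a r]
  simp only [tensorDualEquiv_adjunctionLinear, LinearMap.restrictScalars_apply]
  let B : A →ₗ[k] A →ₗ[k] W :=
    ((HopfTensor.tmul k A U V).compr₂ (f.restrictScalars k)).compl₁₂
      ((Algebra.lsmul k k U).toLinearMap.flip u) ((Algebra.lsmul k k V).toLinearMap.flip v)
  have h := sum_mul_antipode_cancel B r s
  have hB (b c : A) : B b c = f (HopfTensor.tmul k A U V (b • u) (c • v)) := rfl
  simp only [hB, one_smul] at h
  rw [← h]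
  refine Finset.sum_congr rfl fun i _ => ?_
  rw [← map_smul, HopfTensor.smul_tmul _ (s i), map_sum]
  simp only [mul_smul]

/-- With `f u` read as a map `V → W`: `f(a₍₁₎u)(a₍₂₎v) = a₍₁₎ f(u)(S(a₍₂₎)a₍₃₎v) = a f(u)(v)`. -/
theorem adjunctionLinear_symm_smul (f : U →ₗ[A] HopfTensor k A W (HopfDual k A V)) (a : A)
    (u : U) (v : V) :
    (adjunctionLinear k A U V W).symm (f.restrictScalars k) (a • HopfTensor.tmul k A U V u v) =
      a • (adjunctionLinear k A U V W).symm (f.restrictScalars k) (HopfTensor.tmul k A U V u v) := by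
  obtain ⟨g, hg⟩ := (adjunctionLinear k A U V W).surjective (f.restrictScalars k)
  rw [← hg, LinearEquiv.symm_apply_apply]
  have hf (u : U) (v : V) : g (HopfTensor.tmul k A U V u v) = tensorDualEquiv k A V W (f u) v := by
    rw [← tensorDualEquiv_adjunctionLinear, hg, LinearMap.restrictScalars_apply]
  let r := Coalgebra.Repr.arbitrary k a
  let s := fun i => Coalgebra.Repr.arbitrary k (r.left i)
  let B : A →ₗ[k] A →ₗ[k] W := (Algebra.lsmul k k W).toLinearMap.compl₂
    (tensorDualEquiv k A V W (f u) ∘ₗ (Algebra.lsmul k k V).toLinearMap.flip v)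
  have h := sum_antipode_mul_cancel B r s
  have hB (b c : A) : B b c = b • tensorDualEquiv k A V W (f u) (c • v) := rfl
  simp only [hB, one_smul] at h
  rw [hf, ← h, HopfTensor.smul_tmul a r, map_sum]
  refine Finset.sum_congr rfl fun i _ => ?_
  rw [hf, f.map_smul, tensorDualEquiv_smul _ (s i)]
  simp only [mul_smul]

variable (k A U V W) in
/-- The adjunction `Hom_A (U ⊗ V, W) ≅ Hom_A (U, W ⊗ V*)`. -/
def adjunction :
    (HopfTensor k A U V →ₗ[A] W) ≃ₗ[k] (U →ₗ[A] HopfTensor k A W (HopfDual k A V)) where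
  toFun f := { adjunctionLinear k A U V W (f.restrictScalars k) with
    map_smul' := adjunctionLinear_smul f }
  map_add' f g := LinearMap.ext fun u => LinearMap.congr_fun
    (map_add (adjunctionLinear k A U V W) (f.restrictScalars k) (g.restrictScalars k)) u
  map_smul' c f := LinearMap.ext fun u => LinearMap.congr_fun
    (map_smul (adjunctionLinear k A U V W) c (f.restrictScalars k)) u
  invFun f := HopfTensor.equivariant
    ((adjunctionLinear k A U V W).symm (f.restrictScalars k)) (adjunctionLinear_symm_smul f)
  left_inv f := LinearMap.ext fun x => LinearMap.congr_fun
    ((adjunctionLinear k A U V W).symm_apply_apply (f.restrictScalars k)) x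
  right_inv f := LinearMap.ext fun u => LinearMap.congr_fun
    ((adjunctionLinear k A U V W).apply_symm_apply (f.restrictScalars k)) u

theorem tensorDualEquiv_adjunction (f : HopfTensor k A U V →ₗ[A] W) (u : U) (v : V) :
    tensorDualEquiv k A V W (adjunction k A U V W f u) v = f (HopfTensor.tmul k A U V u v) :=
  tensorDualEquiv_adjunctionLinear (f.restrictScalars k) u v

theorem adjunction_comp (f : HopfTensor k A U V →ₗ[A] W) (g : W →ₗ[A] W') :
    adjunction k A U V W' (g ∘ₗ f) =
      HopfTensor.map k (HopfDual k A V) g ∘ₗ adjunction k A U V W f := by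
  ext u
  apply (tensorDualEquiv k A V W').injective
  ext v
  rw [LinearMap.comp_apply, tensorDualEquiv_map, tensorDualEquiv_adjunction,
    tensorDualEquiv_adjunction, LinearMap.comp_apply]

/-- `P ⊗ V` is projective whenever `P` is. -/
theorem HopfTensor.projective [Module.Projective A U] :
    Module.Projective A (HopfTensor k A U V) := by
  refine Module.Projective.of_lifting_property'' fun f hf => ?_
  -- To split the surjection `f` onto `U ⊗ V`, lift the transpose of the identity, `U → (U ⊗ V) ⊗
  -- V*`, through `f ⊗ V*`. By naturality, transposing the lift back gives a section of `f`.
  obtain ⟨h, hh⟩ := Module.projective_lifting_property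
    (HopfTensor.map k (HopfDual k A V) f) (adjunction k A U V _ LinearMap.id)
    (HopfTensor.map_surjective hf)
  refine ⟨(adjunction k A U V _).symm h, ?_⟩
  apply (adjunction k A U V _).injective
  rw [adjunction_comp, LinearEquiv.apply_symm_apply, hh]

end Adjunction

/-! ### Dimensions of Hom spaces, additive on exact sequences and finite products. -/

section HomDimension

variable {k A : Type*} [Field k] [Ring A] [Algebra k A]
  {P N N' N'' T : Type*}
  [AddCommGroup P] [Module k P] [Module A P] [IsScalarTower k A P]
  [AddCommGroup N] [Module k N] [Module A N] [IsScalarTower k A N]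
  [AddCommGroup N'] [Module k N'] [Module A N'] [IsScalarTower k A N']
  [AddCommGroup N''] [Module k N''] [Module A N''] [IsScalarTower k A N'']
  [AddCommGroup T] [Module k T] [Module A T] [IsScalarTower k A T]

theorem finiteDimensional_hom [FiniteDimensional k P] [FiniteDimensional k N] :
    FiniteDimensional k (P →ₗ[A] N) :=
  .of_injective (LinearMap.restrictScalarsₗ k A P N k) (LinearMap.restrictScalars_injective _)

theorem finiteDimensional_submodule [FiniteDimensional k N] (m : Submodule A N) :
    FiniteDimensional k m :=
  .of_injective (m.subtype.restrictScalars k) m.injective_subtype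

variable (k P) in
/-- Postcomposition with an `A`-linear map, as a `k`-linear map. -/
def postcomp (f : N →ₗ[A] N') : (P →ₗ[A] N) →ₗ[k] (P →ₗ[A] N') where
  toFun h := f ∘ₗ h
  map_add' _ _ := LinearMap.comp_add _ _ _
  map_smul' c h := by
    ext x
    exact f.map_smul_of_tower c (h x)

omit [Module k P] [IsScalarTower k A P] in
variable (k P) in
theorem finrank_hom_congr (e : N ≃ₗ[A] N') :
    Module.finrank k (P →ₗ[A] N) = Module.finrank k (P →ₗ[A] N') :=
  LinearEquiv.finrank_eq <| LinearEquiv.ofLinearMap (postcomp k P e.toLinearMap)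
    (postcomp k P e.symm.toLinearMap) (by ext; simp [postcomp]) (by ext; simp [postcomp])

omit [Module k P] [IsScalarTower k A P] in
variable (k N) in
theorem finrank_hom_congr_left {P' : Type*} [AddCommGroup P'] [Module A P'] (e : P ≃ₗ[A] P') :
    Module.finrank k (P →ₗ[A] N) = Module.finrank k (P' →ₗ[A] N) :=
  LinearEquiv.finrank_eq
    { toFun := fun f => f ∘ₗ e.symm.toLinearMap
      invFun := fun f => f ∘ₗ e.toLinearMap
      map_add' := fun _ _ => rfl
      map_smul' := fun _ _ => rfl
      left_inv := fun f => by ext; simp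
      right_inv := fun f => by ext; simp }

theorem finrank_hom_exact [FiniteDimensional k P] [FiniteDimensional k N]
    [Module.Projective A P] {f : N' →ₗ[A] N} {g : N →ₗ[A] N''} (hf : Function.Injective f)
    (hfg : Function.Exact f g) (hg : Function.Surjective g) :
    Module.finrank k (P →ₗ[A] N) =
      Module.finrank k (P →ₗ[A] N') + Module.finrank k (P →ₗ[A] N'') := by
  have := finiteDimensional_hom (k := k) (A := A) (P := P) (N := N)
  have hG : Function.Surjective (postcomp k P g) := fun h =>
    Module.projective_lifting_property g h hg
  have hF : Function.Injective (postcomp k P f) := fun a b hab => by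
    ext x
    exact hf (LinearMap.congr_fun hab x)
  have hker : LinearMap.ker (postcomp k P g) = LinearMap.range (postcomp k P f) := by
    ext h
    constructor
    · intro hh
      -- A map killed by `g` has its values in the range of `f`, so it factors through the injection
      -- `f`.
      have hx (x : P) : ∃ y, f y = h x := (hfg _).1 (LinearMap.congr_fun hh x)
      let r : P →ₗ[A] LinearMap.range f := h.codRestrict _ hx
      refine ⟨(LinearEquiv.ofInjective f hf).symm.toLinearMap ∘ₗ r, ?_⟩
      ext x
      exact congrArg Subtype.val ((LinearEquiv.ofInjective f hf).apply_symm_apply (r x))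
    · rintro ⟨h, rfl⟩
      ext x
      exact (hfg _).2 ⟨_, rfl⟩
  rw [← (postcomp k P g).finrank_range_add_finrank_ker, hker, LinearMap.finrank_range_of_inj hF,
    LinearMap.range_eq_top.2 hG, finrank_top, add_comm]

theorem finrank_hom_submodule [FiniteDimensional k P] [FiniteDimensional k N]
    [Module.Projective A P] (m : Submodule A N) :
    Module.finrank k (P →ₗ[A] N) =
      Module.finrank k (P →ₗ[A] m) + Module.finrank k (P →ₗ[A] (N ⧸ m)) :=
  finrank_hom_exact m.injective_subtype (LinearMap.exact_subtype_mkQ m) m.mkQ_surjective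

theorem finrank_hom_pi {ι : Type*} [Fintype ι] [FiniteDimensional k P] {X : ι → Type*}
    [∀ i, AddCommGroup (X i)] [∀ i, Module k (X i)] [∀ i, Module A (X i)]
    [∀ i, IsScalarTower k A (X i)] [∀ i, FiniteDimensional k (X i)] :
    Module.finrank k (P →ₗ[A] (∀ i, X i)) = ∑ i, Module.finrank k (P →ₗ[A] X i) := by
  have (i : ι) := finiteDimensional_hom (k := k) (A := A) (P := P) (N := X i)
  rw [← Module.finrank_pi_fintype k]
  exact LinearEquiv.finrank_eq
    { toFun := fun f i => LinearMap.proj i ∘ₗ f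
      invFun := LinearMap.pi
      map_add' := fun _ _ => rfl
      map_smul' := fun _ _ => rfl
      left_inv := fun _ => rfl
      right_inv := fun _ => rfl }

theorem finrank_pi_hom {ι : Type*} [Fintype ι] {X : ι → Type*}
    [∀ i, AddCommGroup (X i)] [∀ i, Module k (X i)] [∀ i, Module A (X i)]
    [∀ i, IsScalarTower k A (X i)] [∀ i, FiniteDimensional k (X i)] [FiniteDimensional k N] :
    Module.finrank k ((∀ i, X i) →ₗ[A] N) = ∑ i, Module.finrank k (X i →ₗ[A] N) := by
  classical
  have (i : ι) := finiteDimensional_hom (k := k) (A := A) (P := X i) (N := N)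
  rw [← Module.finrank_pi_fintype k]
  exact (LinearMap.lsum A X k).symm.finrank_eq

end HomDimension

/-! ### Projective covers detect composition multiplicities. -/

section ProjectiveCover

variable {k A : Type*} [Field k] [Ring A] [Algebra k A]
  {P S N T X : Type*}
  [AddCommGroup P] [Module k P] [Module A P] [IsScalarTower k A P] [FiniteDimensional k P]
  [AddCommGroup S] [Module k S] [Module A S] [IsScalarTower k A S] [FiniteDimensional k S]
  [AddCommGroup N] [Module k N] [Module A N] [IsScalarTower k A N] [FiniteDimensional k N]
  [AddCommGroup T] [Module k T] [Module A T] [IsScalarTower k A T] [FiniteDimensional k T]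
  [AddCommGroup X] [Module A X]

omit [Module k P] [IsScalarTower k A P] [FiniteDimensional k P]
  [Module k S] [IsScalarTower k A S] [FiniteDimensional k S] in
theorem IsProjectiveCover.exists_surjective (hP : IsProjectiveCover A P S) :
    ∃ π : P →ₗ[A] S, Function.Surjective π ∧ LinearMap.ker π = Module.jacobson A P := by
  obtain ⟨e⟩ := hP.top_equiv
  exact ⟨e.toLinearMap ∘ₗ (Module.jacobson A P).mkQ,
    e.surjective.comp (Submodule.mkQ_surjective _), by simp [LinearMap.ker_comp]⟩

omit [Module k P] [IsScalarTower k A P] [FiniteDimensional k P]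
  [Module k T] [IsScalarTower k A T] [FiniteDimensional k T] in
theorem jacobson_le_ker [IsSimpleModule A T] (f : P →ₗ[A] T) :
    Module.jacobson A P ≤ LinearMap.ker f := by
  have := Module.le_comap_jacobson f
  rwa [IsSimpleModule.jacobson_eq_bot A T] at this

omit [Module k P] [IsScalarTower k A P] [FiniteDimensional k P]
  [Module k S] [IsScalarTower k A S] [FiniteDimensional k S]
  [Module k T] [IsScalarTower k A T] [FiniteDimensional k T] in
/-- Every map to a simple module factors through the top. -/
theorem exists_factor_of_ker_eq_jacobson [IsSimpleModule A T] {π : P →ₗ[A] S}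
    (hπ : Function.Surjective π) (hker : LinearMap.ker π = Module.jacobson A P) (f : P →ₗ[A] T) :
    ∃ g : S →ₗ[A] T, f = g ∘ₗ π := by
  let e := π.quotKerEquivOfSurjective hπ
  refine ⟨(LinearMap.ker π).liftQ f (hker ▸ jacobson_le_ker f) ∘ₗ e.symm.toLinearMap, ?_⟩
  ext x
  have : e.symm (π x) = (LinearMap.ker π).mkQ x := by
    rw [LinearEquiv.symm_apply_eq]
    rfl
  simp [this]

-- Maps `P → T` factor through the top `S`, so Schur's lemma applies: they are multiples of the
-- projection if `T ≅ S` and vanish otherwise.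
open Classical in
omit [FiniteDimensional k T] in
theorem IsProjectiveCover.finrank_hom_simple [IsAlgClosed k] [IsSimpleModule A S]
    [IsSimpleModule A T] (hP : IsProjectiveCover A P S) :
    Module.finrank k (P →ₗ[A] T) = if Nonempty (T ≃ₗ[A] S) then 1 else 0 := by
  obtain ⟨π, hπ, hker⟩ := hP.exists_surjective
  split_ifs with h
  · obtain ⟨e⟩ := h
    rw [finrank_hom_congr k P e, finrank_eq_one_iff']
    refine ⟨π, ?_, fun f => ?_⟩
    · rintro rfl
      have := IsSimpleModule.nontrivial A S
      obtain ⟨s, hs⟩ := exists_ne (0 : S)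
      obtain ⟨x, hx⟩ := hπ s
      exact hs hx.symm
    · obtain ⟨g, rfl⟩ := exists_factor_of_ker_eq_jacobson hπ hker f
      obtain ⟨c, rfl⟩ := (IsSimpleModule.algebraMap_end_bijective_of_isAlgClosed k).2 g
      exact ⟨c, rfl⟩
  · have : Subsingleton (P →ₗ[A] T) := subsingleton_of_forall_eq 0 fun f => by
      obtain ⟨g, rfl⟩ := exists_factor_of_ker_eq_jacobson hπ hker f
      rcases g.bijective_or_eq_zero with hg | rfl
      · exact (h ⟨(LinearEquiv.ofBijective g hg).symm⟩).elim
      · simp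
    exact Module.finrank_zero_of_subsingleton

omit [Module k S] [IsScalarTower k A S] [FiniteDimensional k S] in
variable (k) in
include k in
/-- Nakayama's lemma for the projective cover. -/
theorem surjective_of_comp_surjective {π : P →ₗ[A] S}
    (hker : LinearMap.ker π = Module.jacobson A P) {f : X →ₗ[A] P}
    (h : Function.Surjective (π ∘ₗ f)) : Function.Surjective f := by
  have : IsNoetherian A P := isNoetherian_of_tower k inferInstance
  rw [← LinearMap.range_eq_top]
  refine (IsCoatomic.eq_top_or_exists_le_coatom _).resolve_right ?_
  rintro ⟨m, hm, hle⟩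
  -- A maximal submodule containing the range of `f` also contains the radical, which is `ker π`;
  -- since `π ∘ f` is onto, these two already span `P`.
  refine hm.1 (eq_top_iff.2 fun x _ => ?_)
  obtain ⟨y, hy⟩ := h (π x)
  have hx : x - f y ∈ LinearMap.ker π := by
    rw [LinearMap.mem_ker, map_sub, sub_eq_zero, ← hy]
    rfl
  rw [hker] at hx
  have := m.add_mem ((sInf_le hm : Module.jacobson A P ≤ m) hx) (hle ⟨y, rfl⟩)
  simpa using this

theorem eq_add_sum_of_succ_eq {n : ℕ} (h : Fin (n + 1) → ℕ) (d : Fin n → ℕ)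
    (hd : ∀ i, h i.succ = h i.castSucc + d i) : h (Fin.last n) = h 0 + ∑ i, d i := by
  induction n with
  | zero => simp
  | succ n ih =>
    rw [Fin.sum_univ_castSucc, ← Fin.succ_last, hd, ← add_assoc]
    congr 1
    exact ih (fun i => h i.castSucc) (fun i => d i.castSucc) fun i => hd i.castSucc

/-- Along a composition series `dim Hom_A(P, -)` grows at each step by 1 or 0, according to whether
the factor is isomorphic to `S`; the total growth is the multiplicity. -/
theorem IsProjectiveCover.compMult_eq_finrank [IsAlgClosed k] [IsSimpleModule A S]
    (hP : IsProjectiveCover A P S) :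
    compMult A N S = Module.finrank k (P →ₗ[A] N) := by
  classical
  have := hP.projective
  have : IsNoetherian A N := isNoetherian_of_tower k inferInstance
  have : IsArtinian A N := isArtinian_of_tower k inferInstance
  obtain ⟨s, h0, h1⟩ := exists_compositionSeries_of_isNoetherian_isArtinian A N
  rw [compMult_eq A s h0 h1, seriesMult, Nat.card_eq_fintype_card, Fintype.card_subtype,
    Finset.card_filter]
  have key := eq_add_sum_of_succ_eq (fun t => Module.finrank k (P →ₗ[A] s t))
    (fun i => if Nonempty ((s i.succ ⧸ (s i.castSucc).comap (s i.succ).subtype) ≃ₗ[A] S)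
      then 1 else 0) fun i => by
    have hlt : s i.castSucc ⋖ s i.succ := s.step i
    have := finiteDimensional_submodule (k := k) (s i.succ)
    have := (covBy_iff_quot_is_simple hlt.le).1 hlt
    rw [← hP.finrank_hom_simple (k := k),
      finrank_hom_submodule (k := k) ((s i.castSucc).comap (s i.succ).subtype),
      finrank_hom_congr k P (Submodule.comapSubtypeEquivOfLe hlt.le)]
  have hbot : Module.finrank k (P →ₗ[A] s 0) = 0 := by
    have h0 : s 0 = ⊥ := h0
    rw [h0]
    exact Module.finrank_zero_of_subsingleton
  have htop : Module.finrank k (P →ₗ[A] s (Fin.last _)) = Module.finrank k (P →ₗ[A] N) := by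
    have h1 : s (Fin.last _) = ⊤ := h1
    rw [h1]
    exact finrank_hom_congr k P Submodule.topEquiv
  rw [htop, hbot, zero_add] at key
  exact key.symm

end ProjectiveCover

/-! ### Splitting off projective quotients and regrouping products. -/

section SplittingOff

variable {A : Type*} [Ring A]

theorem exists_equiv_prod_ker {X P : Type*} [AddCommGroup X] [Module A X] [AddCommGroup P]
    [Module A P] [Module.Projective A P] {f : X →ₗ[A] P} (hf : Function.Surjective f) :
    Nonempty ((P × LinearMap.ker f) ≃ₗ[A] X) := by
  obtain ⟨g, hg⟩ := Module.projective_lifting_property f LinearMap.id hf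
  have hg' (p : P) : f (g p) = p := LinearMap.congr_fun hg p
  refine ⟨LinearEquiv.ofBijective (g.coprod (LinearMap.ker f).subtype) ⟨?_, fun x => ?_⟩⟩
  · rw [← LinearMap.ker_eq_bot, LinearMap.ker_eq_bot']
    rintro ⟨p, x⟩ h
    have h' := congrArg f h
    simp only [LinearMap.coprod_apply, map_add, hg', Submodule.subtype_apply, map_zero,
      LinearMap.mem_ker.1 x.2, add_zero] at h'
    subst h'
    simpa using h
  · exact ⟨(f x, ⟨x - g (f x), by simp [hg']⟩), by simp⟩

/-- Grouping the factors of a product of members of a family. -/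
def piFiberEquiv {ι α : Type*} (P : ι → Type*) [∀ j, AddCommGroup (P j)] [∀ j, Module A (P j)]
    (c : α → ι) : (∀ j, {a // c a = j} → P j) ≃ₗ[A] ∀ a, P (c a) where
  toFun g a := g (c a) ⟨a, rfl⟩
  map_add' _ _ := rfl
  map_smul' _ _ := rfl
  invFun f j a := a.2 ▸ f a.1
  left_inv g := by
    ext j ⟨a, rfl⟩
    rfl
  right_inv _ := rfl

end SplittingOff

/-! ### Existence and uniqueness of decompositions into indecomposable projectives. -/

section Decomposition

variable {k : Type*} {A : Type u} [Field k] [Ring A] [Algebra k A] {ι : Type*}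
  {S : ι → Type*} [∀ i, AddCommGroup (S i)] [∀ i, Module k (S i)] [∀ i, Module A (S i)]
  [∀ i, IsScalarTower k A (S i)] [∀ i, FiniteDimensional k (S i)]
  {P : ι → Type*} [∀ i, AddCommGroup (P i)] [∀ i, Module k (P i)] [∀ i, Module A (P i)]
  [∀ i, IsScalarTower k A (P i)] [∀ i, FiniteDimensional k (P i)]

-- Removes the universe restriction in `exhaustive`: a simple module is isomorphic to some `A ⧸ I`,
-- which lives in the universe of `A`.
omit [∀ i, Module k (S i)] [∀ i, IsScalarTower k A (S i)] [∀ i, FiniteDimensional k (S i)] in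
theorem IsSimpleList.exists_equiv (hS : IsSimpleList (A := A) S) (T : Type*) [AddCommGroup T]
    [Module A T] [IsSimpleModule A T] : ∃ i, Nonempty (T ≃ₗ[A] S i) := by
  obtain ⟨I, hI, ⟨e⟩⟩ := isSimpleModule_iff_quot_maximal.1 ‹IsSimpleModule A T›
  obtain ⟨i, ⟨e'⟩⟩ := hS.exhaustive (A ⧸ I) (e.isSimpleModule_iff.1 inferInstance)
  exact ⟨i, ⟨e.trans e'⟩⟩

theorem IsSimpleList.finrank_hom [IsAlgClosed k] [DecidableEq ι]
    (hS : IsSimpleList (A := A) S) (hP : ∀ i, IsProjectiveCover A (P i) (S i)) (i j : ι) :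
    Module.finrank k (P i →ₗ[A] S j) = if i = j then 1 else 0 := by
  classical
  have := hS.simple
  rw [(hP i).finrank_hom_simple]
  refine if_congr ⟨fun h => (hS.nonisomorphic _ _ h).symm, ?_⟩ rfl rfl
  rintro rfl
  exact ⟨LinearEquiv.refl A _⟩

-- Induction on dimension. A nonzero `X` has a simple quotient `S j`; the quotient map lifts to `X →
-- P j`, which is onto by Nakayama and splits because `P j` is projective. The kernel is projective
-- of smaller dimension.
omit [∀ i, Module k (S i)] [∀ i, IsScalarTower k A (S i)] [∀ i, FiniteDimensional k (S i)] in
variable (k) in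
theorem IsSimpleList.exists_pi_equiv (hS : IsSimpleList (A := A) S)
    (hP : ∀ i, IsProjectiveCover A (P i) (S i)) (d : ℕ) (X : Type*) [AddCommGroup X] [Module k X]
    [Module A X] [IsScalarTower k A X] [FiniteDimensional k X] [Module.Projective A X]
    (hd : Module.finrank k X = d) :
    ∃ (m : ℕ) (c : Fin m → ι), Nonempty (X ≃ₗ[A] ∀ a, P (c a)) := by
  induction d using Nat.strong_induction_on generalizing X with
  | _ d ih =>
  rcases subsingleton_or_nontrivial X with hX | hX
  · exact ⟨0, Fin.elim0, ⟨0⟩⟩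
  have : IsNoetherian A X := isNoetherian_of_tower k inferInstance
  obtain ⟨m, hm, -⟩ := (IsCoatomic.eq_top_or_exists_le_coatom (⊥ : Submodule A X)).resolve_left
    bot_ne_top
  have : IsSimpleModule A (X ⧸ m) := isSimpleModule_iff_isCoatom.2 hm
  obtain ⟨j, ⟨e⟩⟩ := hS.exists_equiv (X ⧸ m)
  obtain ⟨π, hπ, hker⟩ := (hP j).exists_surjective
  obtain ⟨f, hf⟩ := Module.projective_lifting_property π (e.toLinearMap ∘ₗ m.mkQ) hπ
  have hfs : Function.Surjective f := surjective_of_comp_surjective k hker <| by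
    rw [hf]
    exact e.surjective.comp m.mkQ_surjective
  have := (hP j).projective
  have := (hP j).nontrivial
  obtain ⟨E⟩ := exists_equiv_prod_ker hfs
  have : Module.Projective A (P j × LinearMap.ker f) := .of_equiv E.symm
  have : Module.Projective A (LinearMap.ker f) :=
    .of_split (LinearMap.inr A (P j) (LinearMap.ker f)) (LinearMap.snd A _ _) rfl
  have := finiteDimensional_submodule (k := k) (LinearMap.ker f)
  have hlt : Module.finrank k (LinearMap.ker f) < d := by
    have h := (E.restrictScalars k).finrank_eq
    rw [Module.finrank_prod, hd] at h
    have : 0 < Module.finrank k (P j) := Module.finrank_pos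
    omega
  obtain ⟨m, c, ⟨e'⟩⟩ := ih _ hlt (LinearMap.ker f) rfl
  let E₁ : (P j × LinearMap.ker f) ≃ₗ[A] (P j × ∀ a, P (c a)) :=
    (LinearEquiv.refl A (P j)).prodCongr e'
  let E₂ : (P j × ∀ a, P (c a)) ≃ₗ[A] ∀ a, P ((Fin.cons j c : Fin (m + 1) → ι) a) :=
    Fin.consLinearEquiv A fun a => P ((Fin.cons j c : Fin (m + 1) → ι) a)
  exact ⟨m + 1, Fin.cons j c, ⟨E.symm.trans (E₁.trans E₂)⟩⟩

omit [∀ i, Module k (S i)] [∀ i, IsScalarTower k A (S i)] [∀ i, FiniteDimensional k (S i)] in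
variable (k) in
/-- Every projective module of finite dimension is a direct sum of copies of the `P j`. -/
theorem IsSimpleList.exists_decomposition (hS : IsSimpleList (A := A) S)
    (hP : ∀ i, IsProjectiveCover A (P i) (S i)) (X : Type*) [AddCommGroup X] [Module k X]
    [Module A X] [IsScalarTower k A X] [FiniteDimensional k X] [Module.Projective A X] :
    ∃ n : ι → ℕ, Nonempty (X ≃ₗ[A] ((j : ι) → Fin (n j) → P j)) := by
  obtain ⟨m, c, ⟨e⟩⟩ := hS.exists_pi_equiv k hP _ X rfl
  let E : (∀ j, {a // c a = j} → P j) ≃ₗ[A] ((j : ι) → Fin (Nat.card {a // c a = j}) → P j) :=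
    LinearEquiv.piCongrRight fun j =>
      LinearEquiv.funCongrLeft A (P j) (Finite.equivFin {a // c a = j}).symm
  let E' : (∀ a, P (c a)) ≃ₗ[A] (∀ j, {a // c a = j} → P j) := (piFiberEquiv P c).symm
  exact ⟨fun j => Nat.card {a // c a = j}, ⟨e.trans (E'.trans E)⟩⟩

/-- Pairing with `S j` under `dim Hom_A` isolates the exponent of `P j`, so uniqueness needs no
Krull–Schmidt argument. -/
theorem IsSimpleList.decomposition_unique [IsAlgClosed k] [Fintype ι]
    (hS : IsSimpleList (A := A) S) (hP : ∀ i, IsProjectiveCover A (P i) (S i)) {X : Type*}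
    [AddCommGroup X] [Module A X] [Module k X] [IsScalarTower k A X] {n : ι → ℕ}
    (e : X ≃ₗ[A] ((j : ι) → Fin (n j) → P j)) (j : ι) :
    n j = Module.finrank k (X →ₗ[A] S j) := by
  classical
  rw [finrank_hom_congr_left k (S j) e, finrank_pi_hom]
  simp [finrank_pi_hom, hS.finrank_hom hP]

theorem IsSimpleList.decompMult_eq [IsAlgClosed k] [Fintype ι]
    (hS : IsSimpleList (A := A) S) (hP : ∀ i, IsProjectiveCover A (P i) (S i)) (X : Type*)
    [AddCommGroup X] [Module A X] [Module k X] [IsScalarTower k A X] [FiniteDimensional k X]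
    [Module.Projective A X] (j : ι) :
    decompMult A P X j = Module.finrank k (X →ₗ[A] S j) := by
  have h := hS.exists_decomposition k hP X
  rw [decompMult, dif_pos h]
  exact hS.decomposition_unique hP h.choose_spec.some j

theorem IsSimpleList.nonempty_equiv_iff [IsAlgClosed k] [Fintype ι]
    (hS : IsSimpleList (A := A) S) (hP : ∀ i, IsProjectiveCover A (P i) (S i)) (X : Type*)
    [AddCommGroup X] [Module A X] [Module k X] [IsScalarTower k A X] [FiniteDimensional k X]
    [Module.Projective A X] (n : ι → ℕ) :
    Nonempty (X ≃ₗ[A] ((j : ι) → Fin (n j) → P j)) ↔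
      ∀ j, n j = Module.finrank k (X →ₗ[A] S j) := by
  refine ⟨fun ⟨e⟩ => hS.decomposition_unique hP e, fun h => ?_⟩
  obtain ⟨n', ⟨e⟩⟩ := hS.exists_decomposition k hP X
  obtain rfl : n = n' := funext fun j => (h j).trans (hS.decomposition_unique hP e j).symm
  exact ⟨e⟩

end Decomposition

/-! ### Linear algebra of intertwined and symmetric matrices. -/

section MatrixLemmas

open Matrix

variable {ι : Type*} [Fintype ι] [DecidableEq ι]

/-- A nonzero determinant makes `C` invertible over the fraction field; there the matrices are
conjugate, and the characteristic polynomials can be compared there. -/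
theorem charpoly_eq_of_mul_eq_mul {R : Type*} [CommRing R] [IsDomain R] {M N C : Matrix ι ι R}
    (h : N * C = C * M) (hC : C.det ≠ 0) : M.charpoly = N.charpoly := by
  let K := FractionRing R
  have hinj : Function.Injective (algebraMap R K) := IsFractionRing.injective R K
  apply Polynomial.map_injective _ hinj
  rw [← charpoly_map, ← charpoly_map]
  have hC' : IsUnit (C.map (algebraMap R K)) := by
    rw [isUnit_iff_isUnit_det, isUnit_iff_ne_zero]
    change ((algebraMap R K).mapMatrix C).det ≠ 0
    rw [← RingHom.map_det]
    exact (map_ne_zero_iff _ hinj).2 hC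
  obtain ⟨c, hc⟩ := hC'
  have h' : N.map (algebraMap R K) * c = c * M.map (algebraMap R K) := by
    rw [hc, ← Matrix.map_mul, h, Matrix.map_mul]
  rw [← charpoly_units_conj c (M.map (algebraMap R K)), ← h', mul_assoc,
    mul_nonsing_inv _ ((isUnit_iff_isUnit_det _).1 c.isUnit), mul_one]

/-- Eigenvalues are roots of the image of the characteristic polynomial. The comparison thus holds
even in fields where the determinant of the Cartan matrix vanishes. -/
theorem hasEigenvalue_map_iff_of_charpoly_eq {R F : Type*} [CommRing R] [Field F] (f : R →+* F)
    {M N : Matrix ι ι R} (h : M.charpoly = N.charpoly) (μ : F) :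
    Module.End.HasEigenvalue (Matrix.toLin' (M.map f)) μ ↔
      Module.End.HasEigenvalue (Matrix.toLin' (N.map f)) μ := by
  rw [Module.End.hasEigenvalue_iff_isRoot_charpoly, Module.End.hasEigenvalue_iff_isRoot_charpoly,
    Matrix.charpoly_toLin', Matrix.charpoly_toLin', charpoly_map, charpoly_map, h]

theorem exists_orthogonal_diagonalization {M : Matrix ι ι ℝ} (h : M.IsSymm) :
    ∃ O ∈ Matrix.orthogonalGroup ι ℝ, ∃ d : ι → ℝ, M = O * diagonal d * O.transpose := by
  have hM : M.IsHermitian := by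
    rw [Matrix.IsHermitian, conjTranspose_eq_transpose_of_trivial]
    exact h
  refine ⟨hM.eigenvectorUnitary, hM.eigenvectorUnitary.2, hM.eigenvalues, ?_⟩
  have := hM.spectral_theorem
  rw [Unitary.conjStarAlgAut_apply, star_eq_conjTranspose,
    conjTranspose_eq_transpose_of_trivial] at this
  exact this

end MatrixLemmas

/-! ### The McKay, projective McKay and Cartan matrices as Hom dimensions. -/

section McKayMatrices

variable {k : Type*} {A : Type u} [Field k] [IsAlgClosed k] [Ring A] [HopfAlgebra k A]
  {ι : Type*} [Fintype ι]
  {S : ι → Type*} [∀ i, AddCommGroup (S i)] [∀ i, Module k (S i)] [∀ i, Module A (S i)]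
  [∀ i, IsScalarTower k A (S i)] [∀ i, FiniteDimensional k (S i)]
  {P : ι → Type*} [∀ i, AddCommGroup (P i)] [∀ i, Module k (P i)] [∀ i, Module A (P i)]
  [∀ i, IsScalarTower k A (P i)] [∀ i, FiniteDimensional k (P i)]
  (V : Type*) [AddCommGroup V] [Module k V] [Module A V] [IsScalarTower k A V]
  [FiniteDimensional k V]

/-- Expansion of `dim Hom_A (R, N ⊗ V)` over the composition factors of `N`. -/
theorem IsSimpleList.finrank_hom_tensor (hS : IsSimpleList (A := A) S)
    (hP : ∀ i, IsProjectiveCover A (P i) (S i)) (R : Type*) [AddCommGroup R] [Module k R]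
    [Module A R] [IsScalarTower k A R] [FiniteDimensional k R] [Module.Projective A R] (d : ℕ)
    (N : Type*) [AddCommGroup N] [Module k N] [Module A N] [IsScalarTower k A N]
    [FiniteDimensional k N] (hd : Module.finrank k N = d) :
    Module.finrank k (R →ₗ[A] HopfTensor k A N V) =
      ∑ l, Module.finrank k (P l →ₗ[A] N) *
        Module.finrank k (R →ₗ[A] HopfTensor k A (S l) V) := by
  classical
  induction d using Nat.strong_induction_on generalizing N with
  | _ d ih =>
  rcases subsingleton_or_nontrivial N with hN | hN
  · have : Subsingleton (HopfTensor k A N V) := inferInstanceAs (Subsingleton (N ⊗[k] V))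
    simp [Module.finrank_zero_of_subsingleton]
  have : IsNoetherian A N := isNoetherian_of_tower k inferInstance
  obtain ⟨m, hm, -⟩ := (IsCoatomic.eq_top_or_exists_le_coatom (⊥ : Submodule A N)).resolve_left
    bot_ne_top
  have : IsSimpleModule A (N ⧸ m) := isSimpleModule_iff_isCoatom.2 hm
  obtain ⟨j, ⟨e⟩⟩ := hS.exists_equiv (N ⧸ m)
  have := finiteDimensional_submodule (k := k) m
  have (l : ι) := (hP l).projective
  have hlt : Module.finrank k m < d := by
    rw [← hd]
    refine Submodule.finrank_lt (s := m.restrictScalars k) fun h => hm.1 ?_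
    exact eq_top_iff.2 fun x _ => by
      have : x ∈ m.restrictScalars k := h ▸ Submodule.mem_top
      exact this
  -- Both sides are additive on `0 → m → N → N ⧸ m → 0`: the left because `- ⊗ V` is exact and `R`
  -- projective, the right because each `P l` is projective. For the quotient `S j` only `l = j`
  -- contributes.
  rw [finrank_hom_exact (k := k) (HopfTensor.map_injective (k := k) (V := V) m.injective_subtype)
    (HopfTensor.map_exact (LinearMap.exact_subtype_mkQ m) m.mkQ_surjective)
    (HopfTensor.map_surjective m.mkQ_surjective), ih _ hlt m rfl,
    finrank_hom_congr k R (HopfTensor.congr k V e)]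
  simp only [finrank_hom_submodule (k := k) m, finrank_hom_congr k _ e, add_mul,
    Finset.sum_add_distrib, hS.finrank_hom hP]
  simp

omit [Fintype ι] in
theorem IsSimpleList.mckayMatrix_apply (hS : IsSimpleList (A := A) S)
    (hP : ∀ i, IsProjectiveCover A (P i) (S i)) (i j : ι) :
    mckayMatrix k A S V i j = Module.finrank k (P j →ₗ[A] HopfTensor k A (S i) V) := by
  have := hS.simple
  exact congrArg Nat.cast (hP j).compMult_eq_finrank

theorem IsSimpleList.cartanMatrix_apply (k : Type*) {A : Type u} [Field k] [IsAlgClosed k] [Ring A]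
    [Algebra k A] {ι : Type*}
    {S : ι → Type*} [∀ i, AddCommGroup (S i)] [∀ i, Module k (S i)] [∀ i, Module A (S i)]
    [∀ i, IsScalarTower k A (S i)] [∀ i, FiniteDimensional k (S i)]
    {P : ι → Type*} [∀ i, AddCommGroup (P i)] [∀ i, Module k (P i)] [∀ i, Module A (P i)]
    [∀ i, IsScalarTower k A (P i)] [∀ i, FiniteDimensional k (P i)]
    (hS : IsSimpleList (A := A) S)
    (hP : ∀ i, IsProjectiveCover A (P i) (S i)) (i j : ι) :
    cartanMatrix A P S i j = Module.finrank k (P j →ₗ[A] P i) := by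
  have := hS.simple
  exact congrArg Nat.cast (hP j).compMult_eq_finrank

theorem IsSimpleList.projMckayMatrix_apply (hS : IsSimpleList (A := A) S)
    (hP : ∀ i, IsProjectiveCover A (P i) (S i)) (i j : ι) :
    projMckayMatrix k A P V i j = Module.finrank k (HopfTensor k A (P i) V →ₗ[A] S j) := by
  have := (hP i).projective
  have := HopfTensor.projective (k := k) (A := A) (U := P i) (V := V)
  exact congrArg Nat.cast (hS.decompMult_eq hP _ j)

theorem IsSimpleList.projMckayMatrix_eq_transpose (hS : IsSimpleList (A := A) S)
    (hP : ∀ i, IsProjectiveCover A (P i) (S i)) :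
    projMckayMatrix k A P V = (mckayMatrix k A S (HopfDual k A V)).transpose := by
  ext i j
  rw [hS.projMckayMatrix_apply V hP, Matrix.transpose_apply, hS.mckayMatrix_apply _ hP,
    (adjunction k A (P i) V (S j)).finrank_eq]

/-- Both sides have the entries `[P i ⊗ V : S j]`. -/
theorem IsSimpleList.projMckayMatrix_mul_cartanMatrix (hS : IsSimpleList (A := A) S)
    (hP : ∀ i, IsProjectiveCover A (P i) (S i)) :
    projMckayMatrix k A P V * cartanMatrix A P S = cartanMatrix A P S * mckayMatrix k A S V := by
  ext i j
  have (l : ι) := (hP l).projective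
  have := HopfTensor.projective (k := k) (A := A) (U := P i) (V := V)
  simp only [Matrix.mul_apply, hS.projMckayMatrix_apply V hP, hS.cartanMatrix_apply k hP,
    hS.mckayMatrix_apply V hP, ← Nat.cast_mul, ← Nat.cast_sum]
  -- The entry of `C M_V` is now `dim Hom_A(P_j, P_i ⊗ V)`; decomposing `P_i ⊗ V` into the `P_l`
  -- yields the entry of `Q_V C`.
  rw [← hS.finrank_hom_tensor V hP (P j) _ (P i) rfl]
  obtain ⟨n, ⟨e⟩⟩ := hS.exists_decomposition k hP (HopfTensor k A (P i) V)
  rw [finrank_hom_congr k (P j) e, finrank_hom_pi]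
  simp [finrank_hom_pi, ← hS.decomposition_unique hP e]

/-- Over a semisimple ring the radical of `P i` is zero, so `P i` is its own top `S i`. -/
theorem IsSimpleList.cartanMatrix_eq_one (k : Type*) {A : Type u} [Field k] [IsAlgClosed k]
    [Ring A] [Algebra k A] [IsSemisimpleRing A] {ι : Type*} [DecidableEq ι]
    {S : ι → Type*} [∀ i, AddCommGroup (S i)] [∀ i, Module k (S i)] [∀ i, Module A (S i)]
    [∀ i, IsScalarTower k A (S i)] [∀ i, FiniteDimensional k (S i)]
    {P : ι → Type*} [∀ i, AddCommGroup (P i)] [∀ i, Module k (P i)] [∀ i, Module A (P i)]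
    [∀ i, IsScalarTower k A (P i)] [∀ i, FiniteDimensional k (P i)]
    (hS : IsSimpleList (A := A) S)
    (hP : ∀ i, IsProjectiveCover A (P i) (S i)) :
    cartanMatrix A P S = 1 := by
  ext i j
  obtain ⟨π, hπ, hker⟩ := (hP i).exists_surjective
  rw [IsSemisimpleModule.jacobson_eq_bot] at hker
  rw [hS.cartanMatrix_apply k hP, finrank_hom_congr k (P j)
    (LinearEquiv.ofBijective π ⟨LinearMap.ker_eq_bot.1 hker, hπ⟩), hS.finrank_hom hP,
    Matrix.one_apply]
  simp [eq_comm]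

omit [Fintype ι] in
theorem IsSimpleList.mckayMatrix_congr (hS : IsSimpleList (A := A) S)
    (hP : ∀ i, IsProjectiveCover A (P i) (S i)) {V W : Type*}
    [AddCommGroup V] [Module k V] [Module A V] [IsScalarTower k A V] [FiniteDimensional k V]
    [AddCommGroup W] [Module k W] [Module A W] [IsScalarTower k A W] [FiniteDimensional k W]
    (e : V ≃ₗ[A] W) : mckayMatrix k A S V = mckayMatrix k A S W := by
  ext i j
  rw [hS.mckayMatrix_apply V hP, hS.mckayMatrix_apply W hP,
    finrank_hom_congr k _ (HopfTensor.congrRight (S i) e)]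

end McKayMatrices

end McKay

end

/-! ### Assembly of the theorem. -/

theorem theorem2p9
    {k A : Type*} [Field k] [IsAlgClosed k] [Ring A] [HopfAlgebra k A] [FiniteDimensional k A]
    {ι : Type*} [Fintype ι] [DecidableEq ι]
    (S : ι → Type*) [∀ i, AddCommGroup (S i)] [∀ i, Module k (S i)] [∀ i, Module A (S i)]
    [∀ i, IsScalarTower k A (S i)] [∀ i, FiniteDimensional k (S i)]
    (P : ι → Type*) [∀ i, AddCommGroup (P i)] [∀ i, Module k (P i)] [∀ i, Module A (P i)]
    [∀ i, IsScalarTower k A (P i)] [∀ i, FiniteDimensional k (P i)]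
    (hS : McKay.IsSimpleList (A := A) S) (hP : ∀ i, McKay.IsProjectiveCover A (P i) (S i))
    (V : Type*) [AddCommGroup V] [Module k V] [Module A V] [IsScalarTower k A V]
    [FiniteDimensional k V]
    -- the field in which eigenvalues and eigenvectors are taken
    (F : Type*) [Field F] :
    let M : Matrix ι ι ℤ := McKay.mckayMatrix k A S V
    let M' : Matrix ι ι ℤ := McKay.mckayMatrix k A S (McKay.HopfDual k A V)
    let Q : Matrix ι ι ℤ := McKay.projMckayMatrix k A P V
    let C : Matrix ι ι ℤ := McKay.cartanMatrix A P S
    let MF : Matrix ι ι F := M.map (Int.cast : ℤ → F)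
    let MF' : Matrix ι ι F := M'.map (Int.cast : ℤ → F)
    let CF : Matrix ι ι F := C.map (Int.cast : ℤ → F)
    -- `Q` is well defined: `P i ⊗ V` is a direct sum of `n j` copies of the `P j`
    -- for exactly one family `n`, namely row `i` of `Q`
    (∀ i, ∀ n : ι → ℕ,
      Nonempty (McKay.HopfTensor k A (P i) V ≃ₗ[A] ((j : ι) → Fin (n j) → P j)) ↔
        ∀ j, (n j : ℤ) = Q i j) ∧
    -- the chain of equalities for the entries of `Q`
    (∀ i j,
      Q i j = (Module.finrank k (McKay.HopfTensor k A (P i) V →ₗ[A] S j) : ℤ) ∧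
      Module.finrank k (McKay.HopfTensor k A (P i) V →ₗ[A] S j) =
        Module.finrank k (P i →ₗ[A] McKay.HopfTensor k A (S j) (McKay.HopfDual k A V)) ∧
      Module.finrank k (P i →ₗ[A] McKay.HopfTensor k A (S j) (McKay.HopfDual k A V)) =
        McKay.compMult A (McKay.HopfTensor k A (S j) (McKay.HopfDual k A V)) (S i) ∧
      (McKay.compMult A (McKay.HopfTensor k A (S j) (McKay.HopfDual k A V)) (S i) : ℤ) =
        M' j i) ∧
    Q = M'.transpose ∧
    -- (a)
    M'.transpose * C = C * M ∧
    -- (b) right and left eigenvectors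
    (∀ (μ : F) (v : ι → F), MF.mulVec v = μ • v →
      MF'.transpose.mulVec (CF.mulVec v) = μ • CF.mulVec v) ∧
    (∀ (μ : F) (w : ι → F), Matrix.vecMul w MF'.transpose = μ • w →
      Matrix.vecMul (Matrix.vecMul w CF) MF = μ • Matrix.vecMul w CF) ∧
    -- (c) invertible Cartan matrix
    (IsUnit CF → MF'.transpose = CF * MF * CF⁻¹) ∧
    (C.det ≠ 0 →
      M.charpoly = M'.transpose.charpoly ∧ M.charpoly = M'.charpoly ∧
      ∀ μ : F,
        (Module.End.HasEigenvalue (Matrix.toLin' MF) μ ↔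
          Module.End.HasEigenvalue (Matrix.toLin' MF'.transpose) μ) ∧
        (Module.End.HasEigenvalue (Matrix.toLin' MF) μ ↔
          Module.End.HasEigenvalue (Matrix.toLin' MF') μ)) ∧
    -- (d) the semisimple case
    (IsSemisimpleRing A →
      C = 1 ∧ M'.transpose = M ∧
      (Nonempty (V ≃ₗ[A] McKay.HopfDual k A V) →
        M.IsSymm ∧
        ∃ O ∈ Matrix.orthogonalGroup ι ℝ, ∃ d : ι → ℝ,
          M.map (Int.cast : ℤ → ℝ) = O * Matrix.diagonal d * O.transpose)) := by
  intro M M' Q C MF MF' CF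
  have hsimple := hS.simple
  have hproj (i : ι) := (hP i).projective
  have hQ : Q = M'.transpose := hS.projMckayMatrix_eq_transpose V hP
  have hCM : M'.transpose * C = C * M := hQ ▸ hS.projMckayMatrix_mul_cartanMatrix V hP
  -- The integral relation maps to any field; (b) and the conjugation formula in (c) use only this.
  have hCMF : MF'.transpose * CF = CF * MF := by
    have h := congrArg (fun X : Matrix ι ι ℤ => X.map (Int.castRingHom F)) hCM
    simp only [Matrix.map_mul] at h
    exact h
  refine ⟨fun i n => ?_, fun i j => ⟨?_, ?_, ?_, rfl⟩, hQ, hCM, fun μ v hv => ?_,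
    fun μ w hw => ?_, fun hu => ?_, fun hdet => ?_, fun hss => ?_⟩
  · have := McKay.HopfTensor.projective (k := k) (A := A) (U := P i) (V := V)
    rw [hS.nonempty_equiv_iff (k := k) hP]
    refine forall_congr' fun j => ?_
    rw [show Q i j = _ from hS.projMckayMatrix_apply V hP i j, Nat.cast_inj]
  · exact hS.projMckayMatrix_apply V hP i j
  · exact (McKay.adjunction k A (P i) V (S j)).finrank_eq
  · exact (hP i).compMult_eq_finrank.symm
  · rw [Matrix.mulVec_mulVec, hCMF, ← Matrix.mulVec_mulVec, hv, Matrix.mulVec_smul]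
  · rw [Matrix.vecMul_vecMul, ← hCMF, ← Matrix.vecMul_vecMul, hw, Matrix.smul_vecMul]
  · rw [← hCMF, mul_assoc, Matrix.mul_nonsing_inv _ ((Matrix.isUnit_iff_isUnit_det _).1 hu),
      mul_one]
  · have h := McKay.charpoly_eq_of_mul_eq_mul hCM hdet
    have h' : M.charpoly = M'.charpoly := h.trans (Matrix.charpoly_transpose M')
    exact ⟨h, h', fun μ =>
      ⟨McKay.hasEigenvalue_map_iff_of_charpoly_eq (Int.castRingHom F) h μ,
        McKay.hasEigenvalue_map_iff_of_charpoly_eq (Int.castRingHom F) h' μ⟩⟩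
  · have hC : C = 1 := hS.cartanMatrix_eq_one k hP
    have hM : M'.transpose = M := by rw [hC, mul_one, one_mul] at hCM; exact hCM
    refine ⟨hC, hM, fun ⟨e⟩ => ?_⟩
    -- Self-duality gives `M = M'`, and semisimplicity gives `M'ᵀ = M`.
    have hsymm : M.IsSymm := by
      rw [Matrix.IsSymm, show M = M' from hS.mckayMatrix_congr hP e, hM]
      exact hS.mckayMatrix_congr hP e
    exact ⟨hsymm, McKay.exists_orthogonal_diagonalization (hsymm.map _)⟩
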